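/- All codes are binary linear codes; $\mathrm{wt}(x)$ is the number of non-zero coordinates of $x\in\mathbb F_2^n$, the minimum weight $d(U)$ of a set $U\subseteq\mathbb F_2^n$ is the least weight of a non-zero vector in $U$, and an $[n,m,d]$ code is an $m$-dimensional subspace of $\mathbb F_2^n$ of minimum weight $d$. A self-dual code ($C=C^\perp$) is doubly even if all its weights are divisible by $4$, and singly even if some codeword has weight $\equiv 2\pmod 4$. For a singly even self-dual code $C$ let $C_0=\{x\in C : \mathrm{wt}(x)\equiv 0 \pmod 4\}$; its shadow is $S=C_0^\perp\setminus C$, which is the union of two cosets $C_1,C_3$ of $C_0$. Such a code $C$ of length $n$ is called $s$-extremal if $d(S)=\frac n2+4-2d(C)$ (respectively $d(S)=\frac n2+8-2d(C)$ in the exceptional case $n\equiv 22\pmod{24}$, $d(C)=4\lfloor n/24\rfloor+6$). Two self-dual codes of length $n$ are neighbours if their intersection has dimension $n/2-1$. Let $k\ge 0$ and let $C$ be an $s$-extremal singly even self-dual $[24k+8,\,12k+4,\,4k+2]$ code, with $C_0,C_1,C_3$ and $S$ as above. Let $A_i$ and $B_i$ be the numbers of vectors of weight $i$ in $C$ and in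 $S$, respectively. Then $C$ has exactly two doubly even self-dual neighbours, namely $C_0\cup C_1$ and $C_0\cup C_3$. Each of these two codes has a coset of minimum weight $4k+2$, and every coset of minimum weight $4k+2$ of either code has weight enumerator $$\sum_{i\equiv 2 \ (\mathrm{mod}\ 4)} A_i y^i+\sum_i \frac{B_i}{2}\,y^i .$$ -/

import Mathlib

namespace BinCode

/-- A binary linear code of length `n`: a vector subspace of `𝔽₂ⁿ`. The weight of a vector
is Mathlib's `hammingNorm`. -/
abbrev Code (n : ℕ) := Submodule (ZMod 2) (Fin n → ZMod 2)

variable {n : ℕ}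

/-- `X^⊥`: all vectors orthogonal to every element of `X`. -/
def dual (X : Set (Fin n → ZMod 2)) : Code n where
  carrier := {x | ∀ y ∈ X, x ⬝ᵥ y = 0}
  add_mem' := by
    intro a b ha hb y hy
    rw [add_dotProduct, ha y hy, hb y hy, add_zero]
  zero_mem' := fun y _ => zero_dotProduct y
  smul_mem' := by
    intro c a ha y hy
    rw [smul_dotProduct, ha y hy, smul_zero]

def IsSelfDual (C : Code n) : Prop := C = dual (C : Set (Fin n → ZMod 2))

/-- All codewords have weight divisible by four. -/
def IsDoublyEven (C : Code n) : Prop := ∀ x ∈ C, hammingNorm x % 4 = 0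

/-- Some codeword has weight congruent to two modulo four (used for self-dual codes only). -/
def IsSinglyEven (C : Code n) : Prop := ∃ x ∈ C, hammingNorm x % 4 = 2

/-- `d` is the minimum non-zero weight of the vectors in `U`. -/
def HasMinWeight (U : Set (Fin n → ZMod 2)) (d : ℕ) : Prop :=
  IsLeast {w : ℕ | ∃ x ∈ U, x ≠ 0 ∧ hammingNorm x = w} d

/-- `C`, of length `n`, is an `[n, m, d]` code. -/
def IsCode (C : Code n) (m d : ℕ) : Prop :=
  Module.finrank (ZMod 2) C = m ∧ HasMinWeight (C : Set (Fin n → ZMod 2)) d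

/-- `C₀`: the codewords of weight divisible by four. -/
def evenPart (C : Code n) : Set (Fin n → ZMod 2) := {x | x ∈ C ∧ hammingNorm x % 4 = 0}

/-- The shadow `C₀^⊥ \ C`. -/
def shadow (C : Code n) : Set (Fin n → ZMod 2) :=
  (dual (evenPart C) : Set (Fin n → ZMod 2)) \ (C : Set (Fin n → ZMod 2))

/-- `U` is a coset (translate) of `X`. -/
def IsCosetOf (X U : Set (Fin n → ZMod 2)) : Prop := ∃ v, U = (fun x => v + x) '' X

/-- A singly even self-dual code that meets the bound `d(S) ≤ n/2 + 4 - 2 d(C)`; in the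
exceptional case `n ≡ 22 (mod 24)`, `d(C) = 4 ⌊n/24⌋ + 6` the value is `n/2 + 8 - 2 d(C)`. -/
def IsSExtremal (C : Code n) : Prop :=
  IsSelfDual C ∧ IsSinglyEven C ∧ ∃ d s : ℕ,
    HasMinWeight (C : Set (Fin n → ZMod 2)) d ∧ HasMinWeight (shadow C) s ∧
      s + 2 * d = if n % 24 = 22 ∧ d = 4 * (n / 24) + 6 then n / 2 + 8 else n / 2 + 4

/-- Self-dual codes of length `n` that intersect in dimension `n/2 - 1`. -/
def IsNeighbor (C D : Code n) : Prop :=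
  IsSelfDual C ∧ IsSelfDual D ∧
    Module.finrank (ZMod 2) (C ⊓ D : Submodule (ZMod 2) (Fin n → ZMod 2)) + 1 = n / 2

/-- The number of vectors of weight `i` in `U`. -/
noncomputable def wtDist (U : Set (Fin n → ZMod 2)) (i : ℕ) : ℕ :=
  {x | x ∈ U ∧ hammingNorm x = i}.ncard

/-- The weight enumerator `∑ A_i y^i` of `U`. -/
noncomputable def weightEnumerator (U : Set (Fin n → ZMod 2)) : Polynomial ℚ :=
  ∑ i ∈ Finset.range (n + 1), Polynomial.monomial i (wtDist U i : ℚ)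

end BinCode

/-!
Since the length is divisible by `8`, all vectors of the shadow `S` of `C` have weight divisible
by `4` (`IsSelfDual.hammingNorm_mod_four_of_mem_shadow`). As `S` is a coset `s + C` of `C`, it is
the union of two cosets of `C₀`, and adjoining either of them to `C₀` gives a doubly even self-dual
code (`adjoin`). Conversely a doubly even neighbour of `C` meets `C` in `C₀` and thus is generated
by `C₀` and a vector of `C₀^⊥ \ C = S` (`exists_eq_adjoin_of_isNeighbor`).

The hypothesis that `C` is `s`-extremal says that `S` has minimum weight `4 k + 4`, so these
neighbours `D` have no nonzero weights below `4 k + 4`. Containing the all-ones vector, they have at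
most `4 k + 2` nonzero weights. For a coset `v + D` without weights below `4 k + 2`, the MacWilliams
identity (`card_mul_sum_sgn_weight`) shows that the enumerator of `D` twisted by the character
`x ↦ (-1)^(x ⬝ᵥ v)` vanishes at `1` to order `4 k + 2`. The difference of two such twisted
enumerators has no constant term, hence at most `4 k + 2` terms, and is zero by Descartes' rule of
signs. So all such cosets, of either neighbour, have the same weight enumerator
(`weightEnumerator_coset_eq`). Now a vector `c ∈ C` of weight `4 k + 2` yields such a coset of each
neighbour: `C \ C₀` together with the half of `S` outside that neighbour. Comparing the two shows
that the halves of `S` have equal weight enumerators, which gives the formula.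
-/

namespace BinCode

open Polynomial

variable {n : ℕ}

/-! ### Poisson summation over a self-dual code -/

/-- The nontrivial character `a ↦ (-1)^a` of `𝔽₂`, with values in a commutative ring. -/
def sgn (R : Type*) [CommRing R] : AddChar (ZMod 2) R where
  toFun a := if a = 0 then 1 else -1
  map_zero_eq_one' := if_pos rfl
  map_add_eq_mul' a b := by
    have h : ∀ c : ZMod 2, c = 0 ∨ c = 1 := by decide
    rcases h a with rfl | rfl <;> rcases h b with rfl | rfl <;>
      simp [show (1 : ZMod 2) + 1 = 0 from rfl]

lemma sgn_apply (R : Type*) [CommRing R] (a : ZMod 2) : sgn R a = if a = 0 then 1 else -1 := rfl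

/-- A set of vectors, as a finset. -/
noncomputable def words (U : Set (Fin n → ZMod 2)) : Finset (Fin n → ZMod 2) :=
  (Set.toFinite U).toFinset

@[simp] lemma mem_words {U : Set (Fin n → ZMod 2)} {x : Fin n → ZMod 2} :
    x ∈ words U ↔ x ∈ U := by simp [words]

lemma zmod_two_eq_one {a : ZMod 2} (h : a ≠ 0) : a = 1 := by
  fin_cases a
  · exact absurd rfl h
  · rfl

section Poisson

variable {R : Type*} [CommRing R]

lemma sum_sgn_eq_zero (D : Code n) {x y : Fin n → ZMod 2} (hy : y ∈ D) (hxy : x ⬝ᵥ y ≠ 0) :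
    ∑ u ∈ words (D : Set (Fin n → ZMod 2)), sgn R (x ⬝ᵥ u) = 0 := by
  have h1 : sgn R (x ⬝ᵥ y) = -1 := if_neg hxy
  refine Finset.sum_involution (fun u _ => u + y) ?_ ?_ ?_ ?_
  · intro u _
    rw [dotProduct_add, AddChar.map_add_eq_mul, h1]
    ring
  · intro u _ _ h
    apply hxy
    have : y = 0 := by simpa using h
    simp [this]
  · intro u hu
    simp only [mem_words, SetLike.mem_coe] at hu ⊢
    exact D.add_mem hu hy
  · intro u _
    ext j
    simp [add_assoc, CharTwo.add_self_eq_zero]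

lemma prod_ite_eq_pow_hammingNorm (z : Fin n → ZMod 2) (a b : R) :
    ∏ j, (if z j = 0 then a else b) = a ^ (n - hammingNorm z) * b ^ hammingNorm z := by
  have h := Finset.card_filter_add_card_filter_not (s := (Finset.univ : Finset (Fin n)))
    (fun j => z j = 0)
  rw [Finset.card_univ, Fintype.card_fin] at h
  rw [Finset.prod_ite, Finset.prod_const, Finset.prod_const]
  have h2 : hammingNorm z = (Finset.univ.filter fun j => ¬ z j = 0).card := rfl
  rw [h2]
  congr 2
  omega

/-- The Fourier transform over `𝔽₂ⁿ` of the weight function `x ↦ a^(n - wt x) b^(wt x)`. -/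
lemma sum_sgn_mul_weight (z : Fin n → ZMod 2) (a b : R) :
    ∑ x : Fin n → ZMod 2, sgn R (x ⬝ᵥ z) * (a ^ (n - hammingNorm x) * b ^ hammingNorm x) =
      (a + b) ^ (n - hammingNorm z) * (a - b) ^ hammingNorm z := by
  rw [← prod_ite_eq_pow_hammingNorm]
  have h : ∀ j, (if z j = 0 then a + b else a - b) =
      ∑ c : ZMod 2, sgn R (c * z j) * (if c = 0 then a else b) := by
    intro j
    have h2 : ∀ f : ZMod 2 → R, ∑ c, f c = f 0 + f 1 := fun f => Fin.sum_univ_two f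
    rw [h2]
    by_cases hz : z j = 0
    · simp [hz]
    · simp [zmod_two_eq_one hz, sgn_apply, sub_eq_add_neg]
  simp_rw [h]
  rw [Finset.prod_univ_sum, Fintype.piFinset_univ]
  refine Finset.sum_congr rfl fun x _ => ?_
  rw [Finset.prod_mul_distrib, prod_ite_eq_pow_hammingNorm, dotProduct]
  congr 1
  exact map_prod (sgn R).toMonoidHom (fun j => Multiplicative.ofAdd (x j * z j)) Finset.univ

/-- The MacWilliams identity for the coset `v + D` of a self-dual code `D`. -/
theorem card_mul_sum_sgn_weight {D : Code n} (hD : IsSelfDual D) (v : Fin n → ZMod 2) (a b : R) :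
    ((words (D : Set (Fin n → ZMod 2))).card : R) *
      ∑ x ∈ words (D : Set (Fin n → ZMod 2)),
        sgn R (x ⬝ᵥ v) * (a ^ (n - hammingNorm x) * b ^ hammingNorm x) =
      ∑ u ∈ words (D : Set (Fin n → ZMod 2)),
        (a + b) ^ (n - hammingNorm (v + u)) * (a - b) ^ hammingNorm (v + u) := by
  classical
  simp_rw [← sum_sgn_mul_weight, dotProduct_add, AddChar.map_add_eq_mul]
  rw [Finset.sum_comm, Finset.mul_sum,
    ← Finset.sum_subset (Finset.subset_univ (words (D : Set (Fin n → ZMod 2))))]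
  · refine Finset.sum_congr rfl fun x hx => ?_
    rw [mem_words, SetLike.mem_coe, hD] at hx
    have : ∀ u ∈ words (D : Set (Fin n → ZMod 2)), sgn R (x ⬝ᵥ u) = 1 := by
      intro u hu
      rw [hx u (mem_words.1 hu), AddChar.map_zero_eq_one]
    rw [Finset.sum_congr rfl fun u hu => by rw [this u hu, mul_one], Finset.sum_const,
      nsmul_eq_mul]
  · intro x _ hx
    rw [mem_words, SetLike.mem_coe, hD] at hx
    have : ∃ y ∈ D, x ⬝ᵥ y ≠ 0 := by
      by_contra! h
      exact hx h
    obtain ⟨y, hy, hxy⟩ := this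
    rw [← Finset.sum_mul, ← Finset.mul_sum, sum_sgn_eq_zero D hy hxy, mul_zero, zero_mul]

end Poisson

/-! ### Sparse polynomials -/

lemma signVariations_lt_card_support (m : ℕ) (P : ℚ[X]) (hP : P ≠ 0)
    (hm : P.support.card = m) : P.signVariations < m := by
  induction m generalizing P with
  | zero => exact absurd (by simpa using hm) hP
  | succ m ih =>
    by_cases h : P.eraseLead = 0
    · have : P.signVariations = 0 := by
        rw [← eraseLead_add_monomial_natDegree_leadingCoeff P, h, zero_add,
          signVariations_monomial]
      omega
    · have h1 := ih P.eraseLead h (card_support_eraseLead' hm)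
      have h2 := signVariations_le_eraseLead_succ (P := P)
      omega

/-- By Descartes' rule of signs, a nonzero polynomial with at most `m` terms cannot vanish to
order `m` at `1`. -/
lemma eq_zero_of_pow_dvd_of_card_support_le (m : ℕ) (Q : ℚ[X]) (hQ : Q.support.card ≤ m)
    (h : (X - C 1) ^ m ∣ Q) : Q = 0 := by
  by_contra hne
  obtain ⟨P, rfl⟩ := h
  have hP : P ≠ 0 := right_ne_zero_of_mul hne
  have key : ∀ i, i ≤ ((X - C 1) ^ i * P).signVariations := by
    intro i
    induction i with
    | zero => exact Nat.zero_le _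
    | succ i ih =>
      rw [pow_succ', mul_assoc]
      refine (Nat.succ_le_succ ih).trans (succ_signVariations_le_X_sub_C_mul one_pos ?_)
      exact mul_ne_zero (pow_ne_zero _ (X_sub_C_ne_zero 1)) hP
  have := signVariations_lt_card_support _ _ hne rfl
  have := key m
  omega

/-! ### Weight enumerators of cosets -/

lemma hammingNorm_le (x : Fin n → ZMod 2) : hammingNorm x ≤ n := by
  simpa using hammingNorm_le_card_fintype (x := x)

lemma weightEnumerator_eq_sum (U : Set (Fin n → ZMod 2)) :
    weightEnumerator U = ∑ u ∈ words U, (X : ℚ[X]) ^ hammingNorm u := by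
  have hmap : ∀ u ∈ words U, hammingNorm u ∈ Finset.range (n + 1) :=
    fun u _ => Finset.mem_range.2 (Nat.lt_succ_of_le (hammingNorm_le u))
  rw [weightEnumerator, ← Finset.sum_fiberwise_of_maps_to hmap]
  refine Finset.sum_congr rfl fun i _ => ?_
  rw [Finset.sum_congr rfl (g := fun _ => X ^ i)
    fun u hu => by rw [(Finset.mem_filter.1 hu).2], Finset.sum_const, wtDist,
    ← C_mul_X_pow_eq_monomial, ← Set.ncard_coe_finset, nsmul_eq_mul, C_eq_natCast]
  congr 3
  ext x
  simp

/-- The MacWilliams transform of weight enumerators is injective: the substitution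
`X ↦ (1 - y) / (1 + y)` recovers the value at `y` of the weight enumerator. -/
lemma weightEnumerator_eq_of_transform_eq (U V : Set (Fin n → ZMod 2))
    (h : ∑ u ∈ words U, (1 + X : ℚ[X]) ^ (n - hammingNorm u) * (1 - X) ^ hammingNorm u =
      ∑ u ∈ words V, (1 + X : ℚ[X]) ^ (n - hammingNorm u) * (1 - X) ^ hammingNorm u) :
    weightEnumerator U = weightEnumerator V := by
  have key : ∀ (W : Set (Fin n → ZMod 2)) (y : ℚ), y ≠ -1 →
      eval ((1 - y) / (1 + y))
        (∑ u ∈ words W, (1 + X : ℚ[X]) ^ (n - hammingNorm u) * (1 - X) ^ hammingNorm u) =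
      (2 / (1 + y)) ^ n * eval y (weightEnumerator W) := by
    intro W y hy
    have hy' : 1 + y ≠ 0 := fun h0 => hy (by linarith)
    rw [weightEnumerator_eq_sum, eval_finsetSum, eval_finsetSum, Finset.mul_sum]
    refine Finset.sum_congr rfl fun u _ => ?_
    simp only [eval_mul, eval_pow, eval_add, eval_sub, eval_one, eval_X]
    have h1 : 1 + (1 - y) / (1 + y) = 2 / (1 + y) := by field_simp; ring
    have h2 : 1 - (1 - y) / (1 + y) = 2 / (1 + y) * y := by field_simp; ring
    rw [h1, h2, mul_pow, ← mul_assoc, ← pow_add, Nat.sub_add_cancel (hammingNorm_le u)]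
  apply eq_of_infinite_eval_eq
  refine Set.Infinite.mono (s := {y : ℚ | y ≠ -1}) ?_ ?_
  · intro y hy
    have hy' : 1 + y ≠ 0 := fun h0 => hy (by linarith)
    have := key U y hy
    rw [h, key V y hy] at this
    exact (mul_left_cancel₀ (by positivity) this).symm
  · exact (Set.finite_singleton (-1 : ℚ)).infinite_compl

/-! ### Weights in self-dual codes -/

lemma dotProduct_self_eq (x : Fin n → ZMod 2) : x ⬝ᵥ x = (hammingNorm x : ZMod 2) := by
  have h : ∀ a : ZMod 2, a * a = if a ≠ 0 then 1 else 0 := by decide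
  simp only [dotProduct, h]
  rw [Finset.sum_boole]
  rfl

lemma even_hammingNorm_iff {x : Fin n → ZMod 2} : x ⬝ᵥ x = 0 ↔ Even (hammingNorm x) := by
  rw [dotProduct_self_eq, ZMod.natCast_eq_zero_iff_even]

/-- `wt (x + y) = wt x + wt y - 2 |x ∩ y|`, read modulo `4`. -/
lemma hammingNorm_add_mod_four (x y : Fin n → ZMod 2) :
    hammingNorm (x + y) % 4 =
      (hammingNorm x + hammingNorm y + 2 * if x ⬝ᵥ y = 0 then 0 else 1) % 4 := by
  set m := (Finset.univ.filter fun j => x j * y j ≠ 0).card with hm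
  have h1 : hammingNorm (x + y) + 2 * m = hammingNorm x + hammingNorm y := by
    have h : ∀ a b : ZMod 2, (if a + b ≠ 0 then 1 else 0) + 2 * (if a * b ≠ 0 then 1 else 0) =
      (if a ≠ 0 then 1 else 0) + if b ≠ 0 then 1 else 0 := by decide
    rw [hm]
    simp only [hammingNorm, Finset.card_filter, Finset.mul_sum, Pi.add_apply]
    rw [← Finset.sum_add_distrib, ← Finset.sum_add_distrib]
    exact Finset.sum_congr rfl fun j _ => h _ _
  have h2 : x ⬝ᵥ y = (m : ZMod 2) := by
    have h : ∀ a : ZMod 2, a = if a ≠ 0 then 1 else 0 := by decide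
    rw [dotProduct, Finset.sum_congr rfl fun j _ => h (x j * y j), Finset.sum_boole]
  split_ifs with he
  · rw [h2, ZMod.natCast_eq_zero_iff_even] at he
    obtain ⟨r, hr⟩ := he
    omega
  · rw [h2, ZMod.natCast_eq_zero_iff_even, Nat.not_even_iff] at he
    omega

lemma IsSelfDual.dotProduct_eq_zero {C : Code n} (hC : IsSelfDual C) {x y : Fin n → ZMod 2}
    (hx : x ∈ C) (hy : y ∈ C) : x ⬝ᵥ y = 0 := by
  rw [hC] at hx
  exact hx y hy

lemma IsSelfDual.mem {C : Code n} (hC : IsSelfDual C) {x : Fin n → ZMod 2}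
    (h : ∀ y ∈ C, x ⬝ᵥ y = 0) : x ∈ C := by
  rw [hC]
  exact h

lemma IsSelfDual.even_hammingNorm {C : Code n} (hC : IsSelfDual C) {x : Fin n → ZMod 2}
    (hx : x ∈ C) : Even (hammingNorm x) :=
  even_hammingNorm_iff.1 (hC.dotProduct_eq_zero hx hx)

lemma IsSelfDual.eq_of_le {C D : Code n} (hC : IsSelfDual C) (hD : IsSelfDual D) (h : C ≤ D) :
    C = D :=
  le_antisymm h fun _ hx => hC.mem fun _ hy => hD.dotProduct_eq_zero hx (h hy)

/-- A self-dual code contains the all-ones vector. -/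
lemma IsSelfDual.one_mem {C : Code n} (hC : IsSelfDual C) : (1 : Fin n → ZMod 2) ∈ C := by
  refine hC.mem fun y hy => ?_
  have h : ∀ a : ZMod 2, 1 * a = a * a := by decide
  rw [← hC.dotProduct_eq_zero hy hy, dotProduct, dotProduct]
  exact Finset.sum_congr rfl fun j _ => h _

lemma hammingNorm_add_one (x : Fin n → ZMod 2) : hammingNorm (x + 1) + hammingNorm x = n := by
  have h : ∀ a : ZMod 2, (if a + 1 ≠ 0 then 1 else 0) + (if a ≠ 0 then 1 else 0) = 1 := by decide
  simp only [hammingNorm, Finset.card_filter, Pi.add_apply, Pi.one_apply]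
  rw [← Finset.sum_add_distrib, Finset.sum_congr rfl fun j _ => h _]
  simp

/-- In a self-dual code with no nonzero weight below `d`, all weights other than `0` and `n` are
at most `n - d`. -/
lemma IsSelfDual.hammingNorm_add_le {C : Code n} (hC : IsSelfDual C) {d : ℕ}
    (hd : ∀ x ∈ C, x ≠ 0 → d ≤ hammingNorm x) {x : Fin n → ZMod 2} (hx : x ∈ C)
    (hn : hammingNorm x ≠ n) : hammingNorm x + d ≤ n := by
  have h1 := hammingNorm_add_one x
  have h2 := hd (x + 1) (C.add_mem hx hC.one_mem) (by
    rintro h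
    rw [h, hammingNorm_zero] at h1
    omega)
  omega

lemma card_words (D : Code n) :
    (words (D : Set (Fin n → ZMod 2))).card = 2 ^ Module.finrank (ZMod 2) D := by
  have h := Module.natCard_eq_pow_finrank (K := ZMod 2) (V := D)
  rw [Nat.card_zmod] at h
  rw [← h, words, ← Set.ncard_eq_toFinset_card, ← Nat.card_coe_set_eq]
  rfl

/-- The MacWilliams identity at `(1, 1)` reads `|C|² = 2ⁿ`. -/
lemma IsSelfDual.two_mul_finrank {C : Code n} (hC : IsSelfDual C) :
    2 * Module.finrank (ZMod 2) C = n := by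
  have h := card_mul_sum_sgn_weight (R := ℤ) hC 0 1 1
  have hR : ∑ u ∈ words (C : Set (Fin n → ZMod 2)),
      ((1 : ℤ) + 1) ^ (n - hammingNorm (0 + u)) * (1 - 1) ^ hammingNorm (0 + u) = 2 ^ n := by
    rw [Finset.sum_eq_single_of_mem 0 (mem_words.2 C.zero_mem)]
    · simp [one_add_one_eq_two]
    · intro u _ hu
      rw [zero_add, sub_self, zero_pow (by simpa using hu), mul_zero]
  rw [hR] at h
  simp only [dotProduct_zero, AddChar.map_zero_eq_one, one_pow, mul_one, Finset.sum_const,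
    nsmul_eq_mul, card_words] at h
  push_cast at h
  rw [← pow_add, ← two_mul] at h
  exact Nat.pow_right_injective le_rfl (by exact_mod_cast h)

/-! ### The cosets of an extremal doubly even code -/

lemma words_coset {D : Code n} (v : Fin n → ZMod 2) :
    words ((fun x => v + x) '' (D : Set (Fin n → ZMod 2))) =
      (words (D : Set (Fin n → ZMod 2))).image (fun x => v + x) := by
  ext x
  simp

lemma sum_words_coset {M : Type*} [AddCommMonoid M] {D : Code n} (v : Fin n → ZMod 2)
    (f : (Fin n → ZMod 2) → M) :
    ∑ u ∈ words ((fun x => v + x) '' (D : Set (Fin n → ZMod 2))), f u =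
      ∑ x ∈ words (D : Set (Fin n → ZMod 2)), f (v + x) := by
  rw [words_coset, Finset.sum_image]
  intro x _ y _ h
  exact add_left_cancel h

/-- The weight enumerator of `D` twisted by the character `x ↦ (-1)^(x ⬝ᵥ v)`. -/
noncomputable def twistedEnumerator (D : Code n) (v : Fin n → ZMod 2) : ℚ[X] :=
  ∑ x ∈ words (D : Set (Fin n → ZMod 2)), sgn ℚ[X] (x ⬝ᵥ v) * X ^ hammingNorm x

lemma card_mul_twistedEnumerator {D : Code n} (hD : IsSelfDual D) (v : Fin n → ZMod 2) :
    ((words (D : Set (Fin n → ZMod 2))).card : ℚ[X]) * twistedEnumerator D v =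
      ∑ u ∈ words ((fun x => v + x) '' (D : Set (Fin n → ZMod 2))),
        (1 + X : ℚ[X]) ^ (n - hammingNorm u) * (1 - X) ^ hammingNorm u := by
  rw [sum_words_coset, ← card_mul_sum_sgn_weight hD v, twistedEnumerator]
  simp

lemma card_words_pos (D : Code n) : 0 < (words (D : Set (Fin n → ZMod 2))).card :=
  Finset.card_pos.2 ⟨0, mem_words.2 D.zero_mem⟩

lemma pow_dvd_twistedEnumerator {D : Code n} (hD : IsSelfDual D) (v : Fin n → ZMod 2) (m : ℕ)
    (hm : ∀ x ∈ D, m ≤ hammingNorm (v + x)) :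
    (X - C 1) ^ m ∣ twistedEnumerator D v := by
  have h : (X - C 1 : ℚ[X]) ^ m ∣
      ((words (D : Set (Fin n → ZMod 2))).card : ℚ[X]) * twistedEnumerator D v := by
    rw [card_mul_twistedEnumerator hD, sum_words_coset]
    refine Finset.dvd_sum fun x hx => Dvd.dvd.mul_left ?_ _
    refine (pow_dvd_pow _ (hm x (mem_words.1 hx))).trans (pow_dvd_pow_of_dvd ?_ _)
    exact ⟨-1, by rw [C_1]; ring⟩
  rwa [← C_eq_natCast, IsUnit.dvd_mul_left] at h
  rw [isUnit_C, isUnit_iff_ne_zero]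
  exact_mod_cast (card_words_pos D).ne'

lemma coeff_twistedEnumerator (D : Code n) (v : Fin n → ZMod 2) (w : ℕ) :
    (twistedEnumerator D v).coeff w =
      ∑ x ∈ words (D : Set (Fin n → ZMod 2)), if hammingNorm x = w then sgn ℚ (x ⬝ᵥ v) else 0 := by
  rw [twistedEnumerator, finsetSum_coeff]
  refine Finset.sum_congr rfl fun x _ => ?_
  rcases eq_or_ne (hammingNorm x) w with h | h
  · by_cases h0 : x ⬝ᵥ v = 0 <;> simp [sgn_apply, h, h0]
  · by_cases h0 : x ⬝ᵥ v = 0 <;> simp [sgn_apply, h, h0, coeff_X_pow, h.symm]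

lemma coeff_zero_twistedEnumerator (D : Code n) (v : Fin n → ZMod 2) :
    (twistedEnumerator D v).coeff 0 = 1 := by
  rw [coeff_twistedEnumerator, Finset.sum_eq_single 0]
  · simp
  · intro x _ hx
    rw [if_neg (by simpa using hx)]
  · intro h
    exact absurd (mem_words.2 D.zero_mem) h

lemma coeff_twistedEnumerator_eq_zero (D : Code n) (v : Fin n → ZMod 2) {w : ℕ}
    (hw : ∀ x ∈ D, hammingNorm x ≠ w) : (twistedEnumerator D v).coeff w = 0 := by
  rw [coeff_twistedEnumerator]
  exact Finset.sum_eq_zero fun x hx => if_neg (hw x (mem_words.1 hx))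

/-- Doubly even self-dual codes of length `24 k + 8` without nonzero weights below `4 k + 4` have
at most `4 k + 2` nonzero weights, so the twisted enumerators of two of them, which agree at `0`,
agree as soon as both vanish at `1` to order `4 k + 2`. Hence all cosets without
weights below `4 k + 2` have the same weight enumerator, whatever the code. -/
theorem weightEnumerator_coset_eq (k : ℕ) {D E : Code (24 * k + 8)}
    (hD : IsSelfDual D) (hD4 : IsDoublyEven D) (hDd : ∀ x ∈ D, x ≠ 0 → 4 * k + 4 ≤ hammingNorm x)
    (hE : IsSelfDual E) (hE4 : IsDoublyEven E) (hEd : ∀ x ∈ E, x ≠ 0 → 4 * k + 4 ≤ hammingNorm x)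
    (v w : Fin (24 * k + 8) → ZMod 2)
    (hv : ∀ x ∈ D, 4 * k + 2 ≤ hammingNorm (v + x))
    (hw : ∀ x ∈ E, 4 * k + 2 ≤ hammingNorm (w + x)) :
    weightEnumerator ((fun x => v + x) '' (D : Set (Fin (24 * k + 8) → ZMod 2))) =
      weightEnumerator ((fun x => w + x) '' (E : Set (Fin (24 * k + 8) → ZMod 2))) := by
  have hsupp : ∀ F : Code (24 * k + 8), IsSelfDual F → IsDoublyEven F →
      (∀ x ∈ F, x ≠ 0 → 4 * k + 4 ≤ hammingNorm x) → ∀ i, i ≠ 0 →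
      i ∉ insert (24 * k + 8) ((Finset.Icc (k + 1) (5 * k + 1)).image (4 * ·)) →
      ∀ x ∈ F, hammingNorm x ≠ i := by
    rintro F hF hF4 hFd i hi0 hi x hx rfl
    simp only [Finset.mem_insert, Finset.mem_image, Finset.mem_Icc, not_or] at hi
    have h1 := hFd x hx (fun h => hi0 (by rw [h, hammingNorm_zero]))
    have h2 := hF.hammingNorm_add_le hFd hx hi.1
    have h3 := hF4 x hx
    exact hi.2 ⟨hammingNorm x / 4, ⟨by omega, by omega⟩, by omega⟩
  have hQ : twistedEnumerator D v = twistedEnumerator E w := by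
    rw [← sub_eq_zero]
    refine eq_zero_of_pow_dvd_of_card_support_le (4 * k + 2) _ ?_
      (dvd_sub (pow_dvd_twistedEnumerator hD v _ hv) (pow_dvd_twistedEnumerator hE w _ hw))
    refine (Finset.card_le_card
      (t := insert (24 * k + 8) ((Finset.Icc (k + 1) (5 * k + 1)).image (4 * ·))) ?_).trans ?_
    · intro i hi
      by_contra hi'
      rw [mem_support_iff, coeff_sub] at hi
      apply hi
      rcases eq_or_ne i 0 with rfl | hi0
      · rw [coeff_zero_twistedEnumerator, coeff_zero_twistedEnumerator, sub_self]
      · rw [coeff_twistedEnumerator_eq_zero D v (hsupp D hD hD4 hDd i hi0 hi'),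
          coeff_twistedEnumerator_eq_zero E w (hsupp E hE hE4 hEd i hi0 hi'), sub_self]
    · refine (Finset.card_insert_le _ _).trans ?_
      have := Finset.card_image_le (s := Finset.Icc (k + 1) (5 * k + 1)) (f := (4 * ·))
      rw [Nat.card_Icc] at this
      omega
  have hDE : Module.finrank (ZMod 2) D = Module.finrank (ZMod 2) E := by
    have h1 := hD.two_mul_finrank
    have h2 := hE.two_mul_finrank
    omega
  apply weightEnumerator_eq_of_transform_eq
  rw [← card_mul_twistedEnumerator hD, ← card_mul_twistedEnumerator hE, hQ, card_words, card_words,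
    hDE]

/-! ### The shadow -/

/-- Modulo `2`, a shadow vector represents half the weight as a linear functional on the code. -/
lemma IsSelfDual.dotProduct_eq_zero_iff_of_mem_shadow {C : Code n} (hC : IsSelfDual C)
    {s x : Fin n → ZMod 2} (hs : s ∈ shadow C) (hx : x ∈ C) :
    s ⬝ᵥ x = 0 ↔ hammingNorm x % 4 = 0 := by
  have hs0 : ∀ x ∈ C, hammingNorm x % 4 = 0 → s ⬝ᵥ x = 0 := fun x hx hx4 => hs.1 x ⟨hx, hx4⟩
  refine ⟨fun h => ?_, hs0 x hx⟩
  obtain ⟨c, hc, hsc⟩ : ∃ c ∈ C, s ⬝ᵥ c ≠ 0 := by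
    by_contra! h
    exact hs.2 (hC.mem h)
  obtain ⟨r, hr⟩ := hC.even_hammingNorm hc
  obtain ⟨q, hq⟩ := hC.even_hammingNorm hx
  by_contra hx4
  -- If both `x` and `c` have weight `2` modulo `4`, then `x + c` has weight `0`.
  have h1 : s ⬝ᵥ (x + c) = 0 := by
    refine hs0 _ (C.add_mem hx hc) ?_
    have := mt (hs0 c hc) hsc
    rw [hammingNorm_add_mod_four, if_pos (hC.dotProduct_eq_zero hx hc)]
    omega
  rw [dotProduct_add, h, zero_add] at h1
  exact hsc h1

/-- In length divisible by `8` the shadow vectors of a singly even self-dual code have weights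
divisible by `4`. For such a vector `s`, the terms `(-1)^(x ⬝ᵥ s) i^(wt x)`, `x ∈ C`, are all `1`,
so the MacWilliams identity at `(1, i)` makes a sum of `|C|` fourth roots of unity,
the `(-i)^(wt (s + u))`, equal to `|C|`. -/
theorem IsSelfDual.hammingNorm_mod_four_of_mem_shadow {C : Code n} (hC : IsSelfDual C)
    (hn : 8 ∣ n) {s : Fin n → ZMod 2} (hs : s ∈ shadow C) : hammingNorm s % 4 = 0 := by
  obtain ⟨m, rfl⟩ := hn
  have hdim : Module.finrank (ZMod 2) C = 4 * m := by
    have := hC.two_mul_finrank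
    omega
  have h := card_mul_sum_sgn_weight (R := ℂ) hC s 1 Complex.I
  have hL : ∀ x ∈ words (C : Set (Fin (8 * m) → ZMod 2)),
      sgn ℂ (x ⬝ᵥ s) * (1 ^ (8 * m - hammingNorm x) * Complex.I ^ hammingNorm x) = 1 := by
    intro x hx
    have hx' : x ∈ C := mem_words.1 hx
    obtain ⟨r, hr⟩ := hC.even_hammingNorm hx'
    rw [one_pow, one_mul, dotProduct_comm, Complex.I_pow_eq_pow_mod]
    have hiff := hC.dotProduct_eq_zero_iff_of_mem_shadow hs hx'
    rcases (by omega : hammingNorm x % 4 = 0 ∨ hammingNorm x % 4 = 2) with h4 | h4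
    · rw [h4, hiff.2 h4]
      simp
    · rw [sgn_apply, if_neg (mt hiff.1 (by omega)), h4]
      simp
  have hI : (1 + Complex.I) ^ (8 * m) = 2 ^ (4 * m) := by
    have : (1 + Complex.I) ^ 2 = 2 * Complex.I := by
      linear_combination Complex.I_sq
    rw [show 8 * m = 2 * (4 * m) by ring, pow_mul, this, mul_pow, pow_mul Complex.I,
      Complex.I_pow_four, one_pow, mul_one]
  have hR : ∀ z : Fin (8 * m) → ZMod 2,
      (1 + Complex.I) ^ (8 * m - hammingNorm z) * (1 - Complex.I) ^ hammingNorm z =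
        2 ^ (4 * m) * (-Complex.I) ^ hammingNorm z := by
    intro z
    have : 1 - Complex.I = (1 + Complex.I) * -Complex.I := by
      linear_combination Complex.I_sq
    rw [this, mul_pow, ← mul_assoc, ← pow_add, Nat.sub_add_cancel (hammingNorm_le z), hI]
  rw [Finset.sum_congr rfl hL, Finset.sum_congr rfl fun u _ => hR (s + u), ← Finset.mul_sum,
    card_words, hdim] at h
  push_cast at h
  have h' := mul_left_cancel₀ (pow_ne_zero _ two_ne_zero) h
  -- The real parts of the summands are at most `1` and add up to their number.
  have hre : ∑ u ∈ words (C : Set (Fin (8 * m) → ZMod 2)),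
      (1 - ((-Complex.I) ^ hammingNorm (s + u)).re) = 0 := by
    rw [Finset.sum_sub_distrib, ← Complex.re_sum, ← h']
    simp
  have hle : ∀ w : ℕ, 0 ≤ 1 - ((-Complex.I) ^ w).re := by
    intro w
    have := Complex.re_le_norm ((-Complex.I) ^ w)
    simp at this
    linarith
  have h0 := (Finset.sum_eq_zero_iff_of_nonneg fun u _ => hle _).1 hre 0 (mem_words.2 C.zero_mem)
  rw [add_zero] at h0
  have h4 : (-Complex.I) ^ hammingNorm s = (-Complex.I) ^ (hammingNorm s % 4) := by
    conv_lhs => rw [← Nat.div_add_mod (hammingNorm s) 4, pow_add, pow_mul]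
    rw [neg_pow, Complex.I_pow_four]
    norm_num
  rw [h4] at h0
  have : hammingNorm s % 4 < 4 := Nat.mod_lt _ (by norm_num)
  interval_cases hammingNorm s % 4
  · rfl
  all_goals norm_num [pow_succ] at h0

/-! ### The doubly even neighbours -/

/-- The subcode `C₀` of a self-dual code `C`. -/
def evenCode {C : Code n} (hC : IsSelfDual C) : Code n where
  carrier := evenPart C
  add_mem' := by
    rintro x y ⟨hx, hx4⟩ ⟨hy, hy4⟩
    refine ⟨C.add_mem hx hy, ?_⟩
    rw [hammingNorm_add_mod_four, if_pos (hC.dotProduct_eq_zero hx hy)]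
    omega
  zero_mem' := ⟨C.zero_mem, by rw [hammingNorm_zero]⟩
  smul_mem' := by
    intro c x hx
    by_cases h : c = 0
    · rw [h, zero_smul]
      exact ⟨C.zero_mem, by rw [hammingNorm_zero]⟩
    · rwa [zmod_two_eq_one h, one_smul]

lemma mem_evenCode {C : Code n} (hC : IsSelfDual C) {x : Fin n → ZMod 2} :
    x ∈ evenCode hC ↔ x ∈ C ∧ hammingNorm x % 4 = 0 := Iff.rfl

/-- The coset `s + C₀`. -/
abbrev evenCoset (C : Code n) (s : Fin n → ZMod 2) : Set (Fin n → ZMod 2) :=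
  (fun x => s + x) '' evenPart C

/-- The code generated by `C₀` and `s`. -/
def adjoin {C : Code n} (hC : IsSelfDual C) (s : Fin n → ZMod 2) : Code n :=
  evenCode hC ⊔ Submodule.span (ZMod 2) {s}

lemma coe_adjoin {C : Code n} (hC : IsSelfDual C) (s : Fin n → ZMod 2) :
    (adjoin hC s : Set (Fin n → ZMod 2)) = evenPart C ∪ evenCoset C s := by
  ext x
  simp only [adjoin, SetLike.mem_coe, Submodule.mem_sup, Submodule.mem_span_singleton,
    Set.mem_union, Set.mem_image]
  constructor
  · rintro ⟨y, hy, _, ⟨a, rfl⟩, rfl⟩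
    by_cases h : a = 0
    · left
      rw [h, zero_smul, add_zero]
      exact hy
    · right
      exact ⟨y, hy, by rw [zmod_two_eq_one h, one_smul, add_comm]⟩
  · rintro (h | ⟨y, hy, rfl⟩)
    · exact ⟨x, h, 0, ⟨0, zero_smul _ _⟩, add_zero x⟩
    · exact ⟨y, hy, s, ⟨1, one_smul _ _⟩, add_comm y s⟩

lemma add_self_vec (x : Fin n → ZMod 2) : x + x = 0 := by
  ext j
  simp [CharTwo.add_self_eq_zero]

lemma add_add_cancel_vec (x y : Fin n → ZMod 2) : x + (x + y) = y := by
  rw [← add_assoc, add_self_vec, zero_add]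

lemma IsSelfDual.add_mem_shadow {C : Code n} (hC : IsSelfDual C) {s x : Fin n → ZMod 2}
    (hs : s ∈ shadow C) (hx : x ∈ C) :
    s + x ∈ shadow C := by
  refine ⟨fun y hy => ?_, fun h => hs.2 ?_⟩
  · rw [add_dotProduct, hs.1 y hy, hC.dotProduct_eq_zero hx hy.1, add_zero]
  · rw [← add_add_cancel_vec x s, add_comm x s]
    exact C.add_mem hx h

/-- The shadow is a coset of `C`. -/
lemma IsSelfDual.add_mem_of_mem_shadow {C : Code n} (hC : IsSelfDual C) {s t : Fin n → ZMod 2}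
    (hs : s ∈ shadow C)
    (ht : t ∈ shadow C) : s + t ∈ C := by
  refine hC.mem fun y hy => ?_
  have h1 := hC.dotProduct_eq_zero_iff_of_mem_shadow hs hy
  have h2 := hC.dotProduct_eq_zero_iff_of_mem_shadow ht hy
  rw [add_dotProduct]
  by_cases h : s ⬝ᵥ y = 0
  · rw [h, h2.2 (h1.1 h), add_zero]
  · rw [zmod_two_eq_one h, zmod_two_eq_one fun h' => h (h1.2 (h2.1 h'))]
    rfl

/-- `C \ C₀` is a coset of `C₀`. -/
lemma IsSelfDual.evenCoset_eq {C : Code n} (hC : IsSelfDual C) {c : Fin n → ZMod 2} (hc : c ∈ C)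
    (hc4 : hammingNorm c % 4 = 2) :
    evenCoset C c = {x | x ∈ C ∧ hammingNorm x % 4 = 2} := by
  ext x
  constructor
  · rintro ⟨y, ⟨hy, hy4⟩, rfl⟩
    refine ⟨C.add_mem hc hy, ?_⟩
    simp only [hammingNorm_add_mod_four, hC.dotProduct_eq_zero hc hy, if_true]
    omega
  · rintro ⟨hx, hx4⟩
    refine ⟨c + x, ⟨C.add_mem hc hx, ?_⟩, add_add_cancel_vec c x⟩
    rw [hammingNorm_add_mod_four, if_pos (hC.dotProduct_eq_zero hc hx)]
    omega

lemma IsSelfDual.shadow_eq {C : Code n} (hC : IsSelfDual C) {s c : Fin n → ZMod 2}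
    (hs : s ∈ shadow C) (hc : c ∈ C)
    (hc4 : hammingNorm c % 4 = 2) : shadow C = evenCoset C s ∪ evenCoset C (s + c) := by
  ext y
  constructor
  · intro hy
    have hsy := hC.add_mem_of_mem_shadow hs hy
    obtain ⟨r, hr⟩ := hC.even_hammingNorm hsy
    rcases (by omega : hammingNorm (s + y) % 4 = 0 ∨ hammingNorm (s + y) % 4 = 2) with h | h
    · exact Or.inl ⟨s + y, ⟨hsy, h⟩, add_add_cancel_vec s y⟩
    · have : s + y ∈ evenCoset C c := by
        rw [hC.evenCoset_eq hc hc4]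
        exact ⟨hsy, h⟩
      obtain ⟨x, hx, hxy⟩ := this
      refine Or.inr ⟨x, hx, ?_⟩
      simp only at hxy ⊢
      rw [add_assoc, hxy, add_add_cancel_vec]
  · rintro (⟨x, hx, rfl⟩ | ⟨x, hx, rfl⟩)
    · exact hC.add_mem_shadow hs hx.1
    · exact hC.add_mem_shadow (hC.add_mem_shadow hs hc) hx.1

lemma IsSelfDual.disjoint_evenCoset {C : Code n} (hC : IsSelfDual C) {a c : Fin n → ZMod 2}
    (hc4 : hammingNorm c % 4 = 2) :
    Disjoint (evenCoset C a) (evenCoset C (a + c)) := by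
  rw [Set.disjoint_left]
  rintro _ ⟨x, hx, rfl⟩ ⟨y, hy, h⟩
  simp only [add_assoc, add_right_inj] at h
  have : c = y + x := by rw [← h, add_comm c y, add_add_cancel_vec]
  have h4 := ((evenCode hC).add_mem (x := y) (y := x) hy hx).2
  rw [← this] at h4
  omega

lemma isSelfDual_adjoin {C : Code n} (hC : IsSelfDual C) {s : Fin n → ZMod 2} (hs : s ∈ shadow C)
    (hs4 : hammingNorm s % 4 = 0) :
    IsSelfDual (adjoin hC s) := by
  have hss : s ⬝ᵥ s = 0 := even_hammingNorm_iff.2 (Nat.even_iff.2 (by omega))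
  have hmem : ∀ y, y ∈ adjoin hC s ↔ y ∈ evenPart C ∨ y ∈ evenCoset C s := by
    intro y
    rw [← SetLike.mem_coe, coe_adjoin]
    rfl
  have hs0 : ∀ x ∈ evenPart C, s ⬝ᵥ x = 0 := hs.1
  apply le_antisymm
  · intro x hx y hy
    rw [hmem] at hx
    rw [SetLike.mem_coe, hmem] at hy
    rcases hx with hx | ⟨x, hx, rfl⟩ <;> rcases hy with hy | ⟨y, hy, rfl⟩
    · exact hC.dotProduct_eq_zero hx.1 hy.1
    · simp [dotProduct_add, hC.dotProduct_eq_zero hx.1 hy.1, dotProduct_comm x s, hs0 x hx]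
    · simp [add_dotProduct, hC.dotProduct_eq_zero hx.1 hy.1, hs0 y hy]
    · simp [add_dotProduct, dotProduct_add, hC.dotProduct_eq_zero hx.1 hy.1, hs0 y hy,
        dotProduct_comm x s, hs0 x hx, hss]
  · intro y hy
    have hy0 : y ∈ dual (evenPart C) := fun x hx => hy x ((hmem x).2 (Or.inl hx))
    have hys : s ⬝ᵥ y = 0 := by
      rw [dotProduct_comm]
      exact hy s ((hmem s).2 (Or.inr ⟨0, (evenCode hC).zero_mem, add_zero s⟩))
    rw [hmem]
    by_cases hyC : y ∈ C
    · exact Or.inl ⟨hyC, (hC.dotProduct_eq_zero_iff_of_mem_shadow hs hyC).1 hys⟩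
    · have hsy := hC.add_mem_of_mem_shadow hs (t := y) ⟨hy0, hyC⟩
      refine Or.inr ⟨s + y, ⟨hsy, ?_⟩, add_add_cancel_vec s y⟩
      rw [← hC.dotProduct_eq_zero_iff_of_mem_shadow hs hsy, dotProduct_add, hss, hys, add_zero]

lemma isDoublyEven_adjoin {C : Code n} (hC : IsSelfDual C) {s : Fin n → ZMod 2} (hs : s ∈ shadow C)
    (hs4 : hammingNorm s % 4 = 0) : IsDoublyEven (adjoin hC s) := by
  intro x hx
  rw [← SetLike.mem_coe, coe_adjoin] at hx
  rcases hx with hx | ⟨x, hx, rfl⟩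
  · exact hx.2
  · have := hx.2
    simp only [hammingNorm_add_mod_four, hs.1 x hx, if_true]
    omega

lemma inf_adjoin {C : Code n} (hC : IsSelfDual C) {s : Fin n → ZMod 2}
    (hs : s ∈ shadow C) : C ⊓ adjoin hC s = evenCode hC := by
  ext x
  rw [Submodule.mem_inf, ← SetLike.mem_coe (p := adjoin hC s), coe_adjoin]
  constructor
  · rintro ⟨hx, hx' | ⟨y, hy, rfl⟩⟩
    · exact hx'
    · exact absurd hx (hC.add_mem_shadow hs hy.1).2
  · exact fun h => ⟨h.1, Or.inl h⟩

/-- `C₀` has codimension one in `C`, being the kernel of `x ↦ s ⬝ᵥ x` for a shadow vector `s`. -/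
lemma finrank_evenCode {C : Code n} (hC : IsSelfDual C) {s c : Fin n → ZMod 2} (hs : s ∈ shadow C)
    (hc : c ∈ C)
    (hc4 : hammingNorm c % 4 = 2) :
    Module.finrank (ZMod 2) (evenCode hC) + 1 = Module.finrank (ZMod 2) C := by
  let f : C →ₗ[ZMod 2] ZMod 2 := (dotProductBilin (ZMod 2) (ZMod 2) s).comp C.subtype
  have hf : ∀ x : C, f x = s ⬝ᵥ (x : Fin n → ZMod 2) := fun x => rfl
  have h := f.finrank_range_add_finrank_ker
  have hfc : f ⟨c, hc⟩ = 1 := by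
    refine zmod_two_eq_one ?_
    rw [hf, Ne, hC.dotProduct_eq_zero_iff_of_mem_shadow hs hc]
    omega
  have hr : LinearMap.range f = ⊤ := by
    rw [LinearMap.range_eq_top]
    intro a
    exact ⟨a • ⟨c, hc⟩, by rw [map_smul, hfc, smul_eq_mul, mul_one]⟩
  have hk : (LinearMap.ker f).map C.subtype = evenCode hC := by
    ext x
    rw [mem_evenCode, Submodule.mem_map]
    constructor
    · rintro ⟨y, hy, rfl⟩
      rw [LinearMap.mem_ker, hf, hC.dotProduct_eq_zero_iff_of_mem_shadow hs y.2] at hy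
      exact ⟨y.2, hy⟩
    · rintro ⟨hx, hx4⟩
      refine ⟨⟨x, hx⟩, ?_, rfl⟩
      rw [LinearMap.mem_ker, hf, hC.dotProduct_eq_zero_iff_of_mem_shadow hs hx]
      exact hx4
  rw [hr, finrank_top, Module.finrank_self] at h
  rw [← hk, (Submodule.equivMapOfInjective _ C.subtype_injective _).finrank_eq.symm]
  omega

/-- The code `C₀ ∪ (s + C₀)` is a neighbour of `C`. -/
lemma isNeighbor_adjoin {C : Code n} (hC : IsSelfDual C) {s c : Fin n → ZMod 2}
    (hs : s ∈ shadow C) (hs4 : hammingNorm s % 4 = 0) (hc : c ∈ C)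
    (hc4 : hammingNorm c % 4 = 2) : IsNeighbor C (adjoin hC s) :=
  ⟨hC, isSelfDual_adjoin hC hs hs4, by
    rw [inf_adjoin hC hs, finrank_evenCode hC hs hc hc4]
    have := hC.two_mul_finrank
    omega⟩

/-- A doubly even neighbour of `C` meets `C` in `C₀`, so it lies in `C₀^⊥` and is generated by `C₀`
and a shadow vector. -/
lemma exists_eq_adjoin_of_isNeighbor {C : Code n} (hC : IsSelfDual C) {s c : Fin n → ZMod 2}
    (hshadow : ∀ s ∈ shadow C, hammingNorm s % 4 = 0) (hs : s ∈ shadow C) (hc : c ∈ C)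
    (hc4 : hammingNorm c % 4 = 2) {D : Code n} (hD4 : IsDoublyEven D) (hCD : IsNeighbor C D) :
    ∃ t ∈ shadow C, D = adjoin hC t := by
  have hinf : C ⊓ D = evenCode hC := by
    apply Submodule.eq_of_le_of_finrank_eq
    · exact fun x hx => ⟨hx.1, hD4 x hx.2⟩
    · have h1 := finrank_evenCode hC hs hc hc4
      have h2 := hCD.2.2
      have h3 := hC.two_mul_finrank
      omega
  have hle : evenCode hC ≤ D := hinf ▸ inf_le_right
  have hnot : ¬ D ≤ C := by
    intro h
    have := hD4 c (hCD.2.1.eq_of_le hC h ▸ hc)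
    omega
  obtain ⟨t, htD, htC⟩ := SetLike.not_le_iff_exists.1 hnot
  have ht : t ∈ shadow C := ⟨fun y hy => hCD.2.1.dotProduct_eq_zero htD (hle hy), htC⟩
  refine ⟨t, ht, ((isSelfDual_adjoin hC ht (hshadow t ht)).eq_of_le hCD.2.1 ?_).symm⟩
  rw [adjoin, sup_le_iff, Submodule.span_singleton_le_iff_mem]
  exact ⟨hle, htD⟩

lemma adjoin_eq_adjoin {C : Code n} (hC : IsSelfDual C) {s t : Fin n → ZMod 2}
    (h : t ∈ evenCoset C s) :
    adjoin hC t = adjoin hC s := by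
  obtain ⟨x, hx, rfl⟩ := h
  have hx' : x ∈ evenCode hC := hx
  apply le_antisymm <;>
    rw [adjoin, sup_le_iff, Submodule.span_singleton_le_iff_mem] <;>
    refine ⟨le_sup_left, ?_⟩
  · exact add_mem (Submodule.mem_sup_right (Submodule.mem_span_singleton_self s))
      (Submodule.mem_sup_left hx')
  · have := add_mem (Submodule.mem_sup_right (Submodule.mem_span_singleton_self (s + x)))
      (Submodule.mem_sup_left hx' : x ∈ adjoin hC (s + x))
    rwa [add_assoc, add_self_vec, add_zero] at this

/-! ### The cosets of minimum weight `4 k + 2` -/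

lemma weightEnumerator_union {U V : Set (Fin n → ZMod 2)} (h : Disjoint U V) :
    weightEnumerator (U ∪ V) = weightEnumerator U + weightEnumerator V := by
  classical
  have h1 : words (U ∪ V) = words U ∪ words V := by
    ext x
    simp
  have h2 : Disjoint (words U) (words V) := by
    rw [Finset.disjoint_left]
    exact fun x hx hx' => Set.disjoint_left.1 h (mem_words.1 hx) (mem_words.1 hx')
  simp only [weightEnumerator_eq_sum]
  rw [h1, Finset.sum_union h2]

lemma weightEnumerator_sep_mod_four (U : Set (Fin n → ZMod 2)) (r : ℕ) :
    weightEnumerator {x | x ∈ U ∧ hammingNorm x % 4 = r} =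
      ∑ i ∈ (Finset.range (n + 1)).filter (fun i => i % 4 = r),
        monomial i (wtDist U i : ℚ) := by
  rw [weightEnumerator, Finset.sum_filter]
  refine Finset.sum_congr rfl fun i _ => ?_
  split_ifs with h
  · have : {x | x ∈ {x | x ∈ U ∧ hammingNorm x % 4 = r} ∧ hammingNorm x = i} =
        {x | x ∈ U ∧ hammingNorm x = i} := by
      ext x
      constructor
      · rintro ⟨⟨h1, _⟩, h2⟩
        exact ⟨h1, h2⟩
      · rintro ⟨h1, h2⟩
        exact ⟨⟨h1, h2 ▸ h⟩, h2⟩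
    rw [wtDist, this, wtDist]
  · have : {x | x ∈ {x | x ∈ U ∧ hammingNorm x % 4 = r} ∧ hammingNorm x = i} = ∅ := by
      rw [Set.eq_empty_iff_forall_notMem]
      rintro x ⟨⟨_, h1⟩, h2⟩
      exact h (h2 ▸ h1)
    rw [wtDist, this, Set.ncard_empty, Nat.cast_zero, monomial_zero_right]

lemma image_add_adjoin {C : Code n} (hC : IsSelfDual C) (c s : Fin n → ZMod 2) :
    (fun x => c + x) '' (adjoin hC s : Set (Fin n → ZMod 2)) =
      evenCoset C c ∪ evenCoset C (c + s) := by
  rw [coe_adjoin, Set.image_union, Set.image_image]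
  simp only [evenCoset, add_assoc]

/-- For `c ∈ C \ C₀`, the coset `c + D` of `D = C₀ ∪ (s + C₀)` is the union of `C \ C₀` and the half
of the shadow that is not in `D`. -/
lemma weightEnumerator_image_add_adjoin {C : Code n} (hC : IsSelfDual C) {s c : Fin n → ZMod 2}
    (hs : s ∈ shadow C) (hc : c ∈ C) (hc4 : hammingNorm c % 4 = 2) :
    weightEnumerator ((fun x => c + x) '' (adjoin hC s : Set (Fin n → ZMod 2))) =
      (∑ i ∈ (Finset.range (n + 1)).filter (fun i => i % 4 = 2),
        monomial i (wtDist (C : Set (Fin n → ZMod 2)) i : ℚ)) +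
      weightEnumerator (evenCoset C (s + c)) := by
  rw [image_add_adjoin, weightEnumerator_union, hC.evenCoset_eq hc hc4, add_comm c s]
  · congr 1
    exact weightEnumerator_sep_mod_four (C : Set (Fin n → ZMod 2)) 2
  · rw [Set.disjoint_left]
    rintro _ ⟨x, hx, rfl⟩ ⟨y, hy, h⟩
    simp only [add_comm c s] at h
    have := (hC.add_mem_shadow (hC.add_mem_shadow hs hc) hy.1).2
    rw [h] at this
    exact this (C.add_mem hc hx.1)

section

variable {k : ℕ} {C : Code (24 * k + 8)} (hC : IsSelfDual C)
  {s c : Fin (24 * k + 8) → ZMod 2}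

lemma le_hammingNorm_of_mem_adjoin (hs : s ∈ shadow C)
    (hCd : ∀ x ∈ C, x ≠ 0 → 4 * k + 2 ≤ hammingNorm x)
    (hSd : ∀ x ∈ shadow C, 4 * k + 4 ≤ hammingNorm x) :
    ∀ x ∈ adjoin hC s, x ≠ 0 → 4 * k + 4 ≤ hammingNorm x := by
  intro x hx hx0
  rw [← SetLike.mem_coe, coe_adjoin] at hx
  rcases hx with hx | ⟨y, hy, rfl⟩
  · have h1 := hCd x hx.1 hx0
    have h2 := hx.2
    omega
  · exact hSd _ (hC.add_mem_shadow hs hy.1)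

lemma le_hammingNorm_add_of_mem_adjoin (hs : s ∈ shadow C)
    (hCd : ∀ x ∈ C, x ≠ 0 → 4 * k + 2 ≤ hammingNorm x)
    (hSd : ∀ x ∈ shadow C, 4 * k + 4 ≤ hammingNorm x) (hc : c ∈ C)
    (hc4 : hammingNorm c % 4 = 2) :
    ∀ x ∈ adjoin hC s, 4 * k + 2 ≤ hammingNorm (c + x) := by
  intro x hx
  rw [← SetLike.mem_coe, coe_adjoin] at hx
  rcases hx with hx | ⟨y, hy, rfl⟩
  · refine hCd _ (C.add_mem hc hx.1) fun h => ?_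
    have : c = x := by rw [← add_add_cancel_vec x c, add_comm x c, h, add_zero]
    have h2 := hx.2
    rw [← this] at h2
    omega
  · have h := hSd _ (hC.add_mem_shadow (hC.add_mem_shadow hs hy.1) hc)
    rw [add_comm (s + y) c] at h
    change 4 * k + 2 ≤ hammingNorm (c + (s + y))
    omega

/-- The coset `U` has the same weight enumerator as both `c + (C₀ ∪ (s + C₀))` and
`c + (C₀ ∪ (s + c + C₀))`, which contain different halves of the shadow, so the two halves have the
same weight enumerator. -/
lemma weightEnumerator_of_hasMinWeight (hs : s ∈ shadow C)
    (hshadow : ∀ s ∈ shadow C, hammingNorm s % 4 = 0)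
    (hCd : ∀ x ∈ C, x ≠ 0 → 4 * k + 2 ≤ hammingNorm x)
    (hSd : ∀ x ∈ shadow C, 4 * k + 4 ≤ hammingNorm x) (hc : c ∈ C)
    (hc4 : hammingNorm c % 4 = 2) {U : Set (Fin (24 * k + 8) → ZMod 2)}
    (hU : IsCosetOf (adjoin hC s : Set (Fin (24 * k + 8) → ZMod 2)) U)
    (hUd : HasMinWeight U (4 * k + 2)) :
    weightEnumerator U =
      (∑ i ∈ (Finset.range (24 * k + 8 + 1)).filter (fun i => i % 4 = 2),
        monomial i (wtDist (C : Set (Fin (24 * k + 8) → ZMod 2)) i : ℚ)) +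
      ∑ i ∈ Finset.range (24 * k + 8 + 1), monomial i ((wtDist (shadow C) i : ℚ) / 2) := by
  obtain ⟨v, rfl⟩ := hU
  have hds := le_hammingNorm_of_mem_adjoin hC hs hCd hSd
  have hss := isSelfDual_adjoin hC hs (hshadow s hs)
  have hes := isDoublyEven_adjoin hC hs (hshadow s hs)
  have ht : s + c ∈ shadow C := hC.add_mem_shadow hs hc
  have hdt := le_hammingNorm_of_mem_adjoin hC ht hCd hSd
  have hst := isSelfDual_adjoin hC ht (hshadow _ ht)
  have het := isDoublyEven_adjoin hC ht (hshadow _ ht)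
  -- The coset is not `D` itself, since all weights of `D` are divisible by `4`.
  have hv : ∀ x ∈ adjoin hC s, 4 * k + 2 ≤ hammingNorm (v + x) := by
    intro x hx
    refine hUd.2 ⟨v + x, ⟨x, hx, rfl⟩, fun h0 => ?_, rfl⟩
    obtain ⟨_, ⟨y, hy, rfl⟩, _, hw⟩ := hUd.1
    have hvx : v = x := by rw [← add_add_cancel_vec x v, add_comm x v, h0, add_zero]
    have := hes _ (hvx ▸ add_mem hx hy : v + y ∈ adjoin hC s)
    simp only at hw
    omega
  have hcs := le_hammingNorm_add_of_mem_adjoin hC hs hCd hSd hc hc4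
  have hct := le_hammingNorm_add_of_mem_adjoin hC ht hCd hSd hc hc4
  have h1 := weightEnumerator_coset_eq k hss hes hds hss hes hds v c hv hcs
  have h2 := weightEnumerator_coset_eq k hss hes hds hst het hdt v c hv hct
  rw [weightEnumerator_image_add_adjoin hC hs hc hc4] at h1
  rw [weightEnumerator_image_add_adjoin hC ht hc hc4, add_assoc s c c, add_self_vec,
    add_zero] at h2
  have h3 := weightEnumerator_union (hC.disjoint_evenCoset (a := s) hc4)
  rw [← hC.shadow_eq hs hc hc4] at h3
  have h4 : ∑ i ∈ Finset.range (24 * k + 8 + 1), monomial i ((wtDist (shadow C) i : ℚ) / 2) =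
      Polynomial.C (1 / 2) * weightEnumerator (shadow C) := by
    rw [weightEnumerator, Finset.mul_sum]
    refine Finset.sum_congr rfl fun i _ => ?_
    rw [C_mul_monomial]
    congr 1
    ring
  have h5 : (Polynomial.C (1 / 2 : ℚ)) * 2 = 1 := by
    rw [show (2 : ℚ[X]) = Polynomial.C 2 from rfl, ← Polynomial.C_mul]
    norm_num
  rw [h4, h3]
  generalize weightEnumerator (evenCoset C s) = P at *
  generalize weightEnumerator (evenCoset C (s + c)) = Q at *
  have h6 : P = Q := by linear_combination h2 * (-1) + h1
  rw [h1, h6]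
  linear_combination - Q * h5

end

end BinCode

open BinCode in
theorem mainTheorem4 (k : ℕ) (C : BinCode.Code (24 * k + 8))
    (hparam : BinCode.IsCode C (12 * k + 4) (4 * k + 2))
    (hext : BinCode.IsSExtremal C)
    (C₁ C₃ : Set (Fin (24 * k + 8) → ZMod 2))
    (h₁ : BinCode.IsCosetOf (BinCode.evenPart C) C₁)
    (h₃ : BinCode.IsCosetOf (BinCode.evenPart C) C₃)
    (hS : BinCode.shadow C = C₁ ∪ C₃) :
    ∃ D₁ D₃ : BinCode.Code (24 * k + 8),
      (D₁ : Set (Fin (24 * k + 8) → ZMod 2)) = BinCode.evenPart C ∪ C₁ ∧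
      (D₃ : Set (Fin (24 * k + 8) → ZMod 2)) = BinCode.evenPart C ∪ C₃ ∧
      D₁ ≠ D₃ ∧
      (∀ D : BinCode.Code (24 * k + 8),
        (BinCode.IsSelfDual D ∧ BinCode.IsDoublyEven D ∧ BinCode.IsNeighbor C D) ↔
          (D = D₁ ∨ D = D₃)) ∧
      ∀ D : BinCode.Code (24 * k + 8), (D = D₁ ∨ D = D₃) →
        (∃ U : Set (Fin (24 * k + 8) → ZMod 2),
          BinCode.IsCosetOf (D : Set (Fin (24 * k + 8) → ZMod 2)) U ∧
            BinCode.HasMinWeight U (4 * k + 2)) ∧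
        ∀ U : Set (Fin (24 * k + 8) → ZMod 2),
          BinCode.IsCosetOf (D : Set (Fin (24 * k + 8) → ZMod 2)) U →
          BinCode.HasMinWeight U (4 * k + 2) →
          BinCode.weightEnumerator U =
            (∑ i ∈ (Finset.range (24 * k + 8 + 1)).filter (fun i => i % 4 = 2),
              Polynomial.monomial i
                (BinCode.wtDist (C : Set (Fin (24 * k + 8) → ZMod 2)) i : ℚ)) +
            ∑ i ∈ Finset.range (24 * k + 8 + 1),
              Polynomial.monomial i ((BinCode.wtDist (BinCode.shadow C) i : ℚ) / 2) := by
  obtain ⟨-, hmin⟩ := hparam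
  obtain ⟨hC, -, d, w, hd, hw, hdw⟩ := hext
  obtain rfl : d = 4 * k + 2 := hd.unique hmin
  rw [if_neg (by omega)] at hdw
  obtain rfl : w = 4 * k + 4 := by omega
  have hCd : ∀ x ∈ C, x ≠ 0 → 4 * k + 2 ≤ hammingNorm x :=
    fun x hx hx0 => hmin.2 ⟨x, hx, hx0, rfl⟩
  have hSd : ∀ x ∈ shadow C, 4 * k + 4 ≤ hammingNorm x :=
    fun x hx => hw.2 ⟨x, hx, fun h => hx.2 (h ▸ C.zero_mem), rfl⟩
  have hshadow : ∀ s ∈ shadow C, hammingNorm s % 4 = 0 := fun s hs =>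
    hC.hammingNorm_mod_four_of_mem_shadow ⟨3 * k + 1, by ring⟩ hs
  obtain ⟨c, hc, hc0, hcw⟩ := hmin.1
  have hc4 : hammingNorm c % 4 = 2 := by omega
  obtain ⟨s, rfl⟩ := h₁
  obtain ⟨t, rfl⟩ := h₃
  change shadow C = evenCoset C s ∪ evenCoset C t at hS
  have hself : ∀ a, a ∈ evenCoset C a := fun a => ⟨0, (evenCode hC).zero_mem, add_zero a⟩
  have hs : s ∈ shadow C := hS ▸ Or.inl (hself s)
  have ht : t ∈ shadow C := hS ▸ Or.inr (hself t)
  have hts : t ∉ evenCoset C s := by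
    intro h
    have h1 := hC.shadow_eq hs hc hc4
    obtain ⟨x, hx, rfl⟩ := h
    have h2 : s + c ∈ evenCoset C s := by
      have : s + c ∈ shadow C := hC.add_mem_shadow hs hc
      rw [hS] at this
      rcases this with h | ⟨y, hy, h⟩
      · exact h
      · exact ⟨x + y, (evenCode hC).add_mem hx hy, by simp only [← add_assoc]; exact h⟩
    exact Set.disjoint_left.1 (hC.disjoint_evenCoset hc4) h2 (hself _)
  refine ⟨adjoin hC s, adjoin hC t, coe_adjoin hC s, coe_adjoin hC t, ?_, ?_, ?_⟩
  · intro h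
    have : t ∈ (adjoin hC s : Set (Fin (24 * k + 8) → ZMod 2)) := by
      rw [h, coe_adjoin]
      exact Or.inr (hself t)
    rw [coe_adjoin] at this
    rcases this with h | h
    · exact ht.2 h.1
    · exact hts h
  · intro D
    constructor
    · rintro ⟨-, hD4, hCD⟩
      obtain ⟨r, hr, rfl⟩ := exists_eq_adjoin_of_isNeighbor hC hshadow hs hc hc4 hD4 hCD
      rw [hS] at hr
      exact hr.imp (adjoin_eq_adjoin hC) (adjoin_eq_adjoin hC)
    · have key : ∀ r ∈ shadow C, IsSelfDual (adjoin hC r) ∧ IsDoublyEven (adjoin hC r) ∧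
          IsNeighbor C (adjoin hC r) := fun r hr =>
        ⟨isSelfDual_adjoin hC hr (hshadow r hr), isDoublyEven_adjoin hC hr (hshadow r hr),
          isNeighbor_adjoin hC hr (hshadow r hr) hc hc4⟩
      rintro (rfl | rfl)
      · exact key s hs
      · exact key t ht
  · intro D hD
    obtain ⟨r, hr, rfl⟩ : ∃ r ∈ shadow C, D = adjoin hC r :=
      hD.elim (fun h => ⟨s, hs, h⟩) fun h => ⟨t, ht, h⟩
    refine ⟨⟨_, ⟨c, rfl⟩, ⟨c, ⟨0, zero_mem _, add_zero c⟩, hc0, hcw⟩, ?_⟩, fun U hU hUd =>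
      weightEnumerator_of_hasMinWeight hC hr hshadow hCd hSd hc hc4 hU hUd⟩
    rintro _ ⟨_, ⟨x, hx, rfl⟩, -, rfl⟩
    exact le_hammingNorm_add_of_mem_adjoin hC hr hCd hSd hc hc4 x hx
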